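/- **Setting.** Fix an algebraic theory $\mathbf{Type}$, i.e. a small category with finite products. A *schema* $S$ consists of a small category $S_e$ (entities) and a functor $S_o\colon S_e^{\mathrm{op}}\times\mathbf{Type}\to\mathbf{Set}$ (observables) such that $S_o(e,-)$ preserves finite products for every $e$. Its *collage* $\widetilde S$ is the category with objects $\mathrm{Ob}(S_e)\sqcup\mathrm{Ob}(\mathbf{Type})$ that contains $S_e$ and $\mathbf{Type}$ as full subcategories and has $\widetilde S(e,\tau)=S_o(e,\tau)$, $\widetilde S(\tau,e)=\varnothing$ for $e\in S_e$, $\tau\in\mathbf{Type}$. The category $S\text{-}\mathbf{Inst}$ of *instances* is the full subcategory of $[\widetilde S,\mathbf{Set}]$ on the functors whose restriction to $\mathbf{Type}$ preserves finite products; $\mathbf y\colon\widetilde S^{\mathrm{op}}\to S\text{-}\mathbf{Inst}$, $\mathbf y(x)=\widetilde S(x,-)$, is the Yoneda embedding. A *schema mapping* $F\colon R\to S$ is a functor $F_e\colon R_e\to S_e$ together with a natural transformation $R_o(e,\tau)\to S_o(F_e e,\tau)$; it induces a functor $\widetilde F\colon\widetilde R\to\widetilde S$ that is the identity on $\mathbf{Type}$.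 Precomposition with $\widetilde F$ is a functor $\Delta_F\colon S\text{-}\mathbf{Inst}\to R\text{-}\mathbf{Inst}$; it has a left adjoint $\Sigma_F$ and a right adjoint $\Pi_F$. A *bimodule* $M$ from $R$ to $S$ is a functor $M\colon\widetilde R^{\mathrm{op}}\to S\text{-}\mathbf{Inst}$ with $M(\tau)=\mathbf y(\tau)$, naturally in $\tau\in\mathbf{Type}$. It determines $\Lambda_M\colon R\text{-}\mathbf{Inst}\to S\text{-}\mathbf{Inst}$, the (pointwise) left Kan extension of $M$ along $\mathbf y\colon\widetilde R^{\mathrm{op}}\to R\text{-}\mathbf{Inst}$, and its right adjoint $\Gamma_M\colon S\text{-}\mathbf{Inst}\to R\text{-}\mathbf{Inst}$, $\Gamma_M(J)=S\text{-}\mathbf{Inst}(M(-),J)$. The *companion* of a schema mapping $F\colon R\to S$ is the bimodule $\hat F=\mathbf y\circ\widetilde F^{\mathrm{op}}$ from $R$ to $S$, and its *conjoint* is the bimodule $\check F=\Delta_F\circ\mathbf y$ from $S$ to $R$. **Lemma.** For every schema mapping $F\colon R\to S$ there are natural isomorphisms $$\alpha\colon\Sigma_F\cong\Lambda_{\hat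 F},\qquad \beta\colon\Delta_F\cong\Gamma_{\hat F},\qquad \gamma\colon\Delta_F\cong\Lambda_{\check F},\qquad \delta\colon\Pi_F\cong\Gamma_{\check F}$$ (so that also $\Lambda_{\check F}\cong\Gamma_{\hat F}$) which are compatible with the adjunctions: $\alpha$ and $\beta$ transport the adjunction $\Sigma_F\dashv\Delta_F$ to the canonical adjunction $\Lambda_{\hat F}\dashv\Gamma_{\hat F}$, and $\gamma$ and $\delta$ transport the adjunction $\Delta_F\dashv\Pi_F$ to the canonical adjunction $\Lambda_{\check F}\dashv\Gamma_{\check F}$. -/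

import Mathlib

open CategoryTheory CategoryTheory.Limits Opposite

universe u

namespace AlgData

section Reflection

variable {𝒯 : Type u} [SmallCategory 𝒯] {C : Type u} [SmallCategory C] (P : 𝒯 ⥤ C)

/-- Functors `C ⥤ Type u` whose restriction along `P` preserves finite products. -/
def algebraicAlong : ObjectProperty (C ⥤ Type u) :=
  fun I => PreservesFiniteProducts (P ⋙ I)

variable [HasFiniteProducts 𝒯]

/-- The comparison maps with respect to which being local means preserving products. -/
noncomputable def prodComparison (x : Σ n : ℕ, Fin n → 𝒯) :
    (∐ fun k => coyoneda.obj (op (P.obj (x.2 k)))) ⟶ coyoneda.obj (op (P.obj (∏ᶜ x.2))) :=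
  Sigma.desc fun k => coyoneda.map (P.map (Pi.π x.2 k)).op

/-- A set-valued functor preserves finite products iff it does so on chosen products. -/
theorem preservesFiniteProducts_iff_bijective (G : 𝒯 ⥤ Type u) :
    PreservesFiniteProducts G ↔ ∀ (n : ℕ) (f : Fin n → 𝒯),
      Function.Bijective (fun (z : G.obj (∏ᶜ f)) (k : Fin n) => G.map (Pi.π f k) z) := by
  have key : ∀ (n : ℕ) (f : Fin n → 𝒯), IsIso (piComparison G f) ↔
      Function.Bijective (fun (z : G.obj (∏ᶜ f)) (k : Fin n) => G.map (Pi.π f k) z) := by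
    intro n f
    have h : piComparison G f ≫ (Types.productIso.{0, u} (fun k => G.obj (f k))).hom =
        TypeCat.ofHom (fun (z : G.obj (∏ᶜ f)) (k : Fin n) => G.map (Pi.π f k) z) := by
      ext z k
      exact ConcreteCategory.congr_hom (piComparison_comp_π G f k) z
    rw [← isIso_comp_right_iff _ (Types.productIso.{0, u} (fun k => G.obj (f k))).hom, h,
      isIso_iff_bijective]
    rfl
  constructor
  · intro h n f
    rw [← key]
    infer_instance
  · intro h
    refine ⟨fun n => ?_⟩
    have : ∀ f : Fin n → 𝒯, PreservesLimit (Discrete.functor f) G := fun f => by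
      have := (key n f).2 (h n f)
      exact PreservesProduct.of_iso_comparison G f
    exact preservesLimitsOfShape_of_discrete G

/-- Preserving products along `P` is an orthogonality condition. -/
theorem algebraicAlong_eq_isLocal :
    algebraicAlong P = (MorphismProperty.ofHoms (prodComparison P)).isLocal := by
  ext I
  have key : ∀ (x : Σ n : ℕ, Fin n → 𝒯),
      Function.Bijective (fun (z : (P ⋙ I).obj (∏ᶜ x.2)) (k : Fin x.1) =>
        (P ⋙ I).map (Pi.π x.2 k) z) ↔
      Function.Bijective (fun (g : _ ⟶ I) => prodComparison P x ≫ g) := by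
    intro x
    let e : ((∐ fun k => coyoneda.obj (op (P.obj (x.2 k)))) ⟶ I) ≃
        (∀ k, I.obj (P.obj (x.2 k))) :=
      { toFun := fun g k => coyonedaEquiv (Sigma.ι (fun k => coyoneda.obj (op (P.obj (x.2 k)))) k ≫ g)
        invFun := fun z => Sigma.desc fun k => coyonedaEquiv.symm (z k)
        left_inv := fun g => Sigma.hom_ext _ _ fun k => by simp
        right_inv := fun z => by funext k; simp }
    rw [← Function.Bijective.of_comp_iff' e.bijective,
      ← Function.Bijective.of_comp_iff _ (coyonedaEquiv (F := I)).symm.bijective]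
    refine iff_of_eq (congrArg _ ?_)
    funext z k
    simp [e, prodComparison, ← coyonedaEquiv_symm_map]
  refine (preservesFiniteProducts_iff_bijective (P ⋙ I)).trans ⟨?_, ?_⟩
  · rintro h _ _ _ ⟨x⟩
    exact (key x).1 (h x.1 x.2)
  · intro h n f
    exact (key ⟨n, f⟩).2 (h _ ⟨_⟩)

instance isCardinalPresentable_coyoneda (κ : Cardinal.{u}) [Fact κ.IsRegular] (c : C) :
    IsCardinalPresentable (coyoneda.obj (op c) : C ⥤ Type u) κ where
  preservesColimitOfShape J _ _ := by
    let e : (coyoneda.obj (op (coyoneda.obj (op c) : C ⥤ Type u))) ≅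
        (evaluation C (Type u)).obj c ⋙ uliftFunctor.{u} :=
      NatIso.ofComponents (fun P ↦ Equiv.toIso (coyonedaEquiv.trans Equiv.ulift.symm))
    exact preservesColimitsOfShape_of_natIso e.symm

/-- The product-preserving functors form a reflective subcategory. -/
instance isRightAdjoint_ι_algebraicAlong : (algebraicAlong P).ι.IsRightAdjoint := by
  rw [algebraicAlong_eq_isLocal]
  have : Fact Cardinal.aleph0.{u}.IsRegular := Cardinal.fact_isRegular_aleph0
  refine MorphismProperty.isRightAdjoint_ι_isLocal _ Cardinal.aleph0.{u} ?_
  rintro _ _ _ ⟨x⟩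
  refine ⟨?_, inferInstance⟩
  have : ∀ k : Discrete (Fin x.1), IsCardinalPresentable
      ((Discrete.functor fun k => (coyoneda.obj (op (P.obj (x.2 k))) : C ⥤ Type u)).obj k)
      Cardinal.aleph0.{u} := fun k => isCardinalPresentable_coyoneda _ _
  refine isCardinalPresentable_of_isColimit.{u} _ (coproductIsCoproduct _) _ ?_
  exact hasCardinalLT_of_finite _ _ le_rfl

/-- The category of product-preserving functors is cocomplete. -/
instance hasColimits_algebraicAlong : HasColimitsOfSize.{u, u} (algebraicAlong P).FullSubcategory :=
  letI : Reflective (algebraicAlong P).ι := ⟨_, Adjunction.ofIsRightAdjoint _⟩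
  hasColimits_of_reflective (algebraicAlong P).ι

end Reflection


section Schemas

variable (𝒯 : Type u) [SmallCategory 𝒯]

/-- A schema over the algebraic theory `𝒯` (the type side): a category `Ent` of entities and an
algebraic profunctor `obs` from `Ent` to `𝒯` of observables, i.e. a functor `Entᵒᵖ × 𝒯 ⥤ Set` that
preserves finite products in the second variable. -/
structure Schema where
  Ent : Type u
  [cat : SmallCategory Ent]
  obs : Entᵒᵖ ⥤ 𝒯 ⥤ Type u
  obs_algebraic : ∀ e, PreservesFiniteProducts (obs.obj e)

attribute [instance] Schema.cat

variable {𝒯}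

/-- Objects of the collage of the observables profunctor of `S`. -/
inductive Collage (S : Schema 𝒯) : Type u
  | ent (e : S.Ent) : Collage S
  | typ (τ : 𝒯) : Collage S

namespace Collage

variable {S : Schema 𝒯}

/-- Morphisms of the collage: an entity has its observables as morphisms to types, and there are no
morphisms from types to entities. -/
def Hom : Collage S → Collage S → Type u
  | ent a, ent b => a ⟶ b
  | ent a, typ τ => (S.obs.obj (op a)).obj τ
  | typ _, ent _ => PEmpty
  | typ σ, typ τ => σ ⟶ τ

/-- Identities of the collage. -/
def id : ∀ x : Collage S, Hom x x
  | ent a => 𝟙 a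
  | typ τ => 𝟙 τ

/-- Composition in the collage, through the two actions on observables. -/
def comp : ∀ {x y z : Collage S}, Hom x y → Hom y z → Hom x z
  | ent a, ent b, ent c, f, g => CategoryStruct.comp (X := a) (Y := b) (Z := c) f g
  | ent a, ent b, typ τ, f, g => (S.obs.map (Quiver.Hom.op (X := a) (Y := b) f)).app τ g
  | ent a, typ σ, typ τ, f, g => (S.obs.obj (op a)).map (X := σ) (Y := τ) g f
  | typ ρ, typ σ, typ τ, f, g => CategoryStruct.comp (X := ρ) (Y := σ) (Z := τ) f g

instance : SmallCategory (Collage S) where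
  Hom := Hom
  id := id
  comp := comp
  id_comp {x y} f := by
    cases x <;> cases y <;> first | exact f.elim | skip
    · exact Category.id_comp (obj := S.Ent) f
    · exact ConcreteCategory.congr_hom (NatTrans.congr_app (S.obs.map_id _) _) f
    · exact Category.id_comp (obj := 𝒯) f
  comp_id {x y} f := by
    cases x <;> cases y <;> first | exact f.elim | skip
    · exact Category.comp_id (obj := S.Ent) f
    · exact ConcreteCategory.congr_hom ((S.obs.obj _).map_id _) f
    · exact Category.comp_id (obj := 𝒯) f
  assoc {w x y z} f g h := by
    cases w <;> cases x <;> cases y <;> cases z <;>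
      first | exact f.elim | exact g.elim | exact h.elim | skip
    · exact Category.assoc (obj := S.Ent) f g h
    · exact ConcreteCategory.congr_hom (NatTrans.congr_app
        (S.obs.map_comp (Quiver.Hom.op g) (Quiver.Hom.op f)) _) h
    · exact (ConcreteCategory.congr_hom ((S.obs.map (Quiver.Hom.op f)).naturality _) g).symm
    · exact (ConcreteCategory.congr_hom ((S.obs.obj _).map_comp _ _) f).symm
    · exact Category.assoc (obj := 𝒯) f g h

end Collage

/-- The inclusion of the type side into the collage. -/
def inclType (S : Schema 𝒯) : 𝒯 ⥤ Collage S where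
  obj := Collage.typ
  map f := f

/-- A functor on the collage is an instance if its restriction to the type side preserves finite
products. -/
abbrev IsInstance (S : Schema 𝒯) : ObjectProperty (Collage S ⥤ Type u) := algebraicAlong (inclType S)

/-- The category of instances on `S`, a full subcategory of the functors from the collage to sets. -/
abbrev Inst (S : Schema 𝒯) : Type (u + 1) := (IsInstance S).FullSubcategory

theorem isInstance_coyoneda (S : Schema 𝒯) (x : (Collage S)ᵒᵖ) :
    IsInstance S (coyoneda.obj x) := by
  induction x using Opposite.rec with | op x => ?_
  cases x with
  | ent e =>
    have := S.obs_algebraic (op e)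
    exact this
  | typ τ =>
    exact (inferInstance : PreservesFiniteProducts (coyoneda.obj (op τ)))

/-- The Yoneda embedding, sending `x` to the representable instance of morphisms out of `x`. -/
def yon (S : Schema 𝒯) : (Collage S)ᵒᵖ ⥤ Inst S :=
  (IsInstance S).lift coyoneda (isInstance_coyoneda S)

/-- The Yoneda lemma for instances: morphisms `y(r) ⟶ I` are the elements of `I(r)`. -/
def yonEquiv {R : Schema 𝒯} {I : Inst R} {r : (Collage R)ᵒᵖ} :
    ((yon R).obj r ⟶ I) ≃ I.obj.obj r.unop :=
  ((IsInstance R).fullyFaithfulι.homEquiv).trans coyonedaEquiv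

theorem yonEquiv_symm_map {R : Schema 𝒯} {I : Inst R} {r s : Collage R} (f : r ⟶ s) (x : I.obj.obj r) :
    (yonEquiv (r := op s)).symm (I.obj.map f x) = (yon R).map f.op ≫ (yonEquiv (r := op r)).symm x := by
  apply (IsInstance R).hom_ext
  exact coyonedaEquiv_symm_map f x

theorem yonEquiv_symm_comp {R : Schema 𝒯} {I J : Inst R} {r : Collage R} (x : I.obj.obj r) (g : I ⟶ J) :
    (yonEquiv (r := op r)).symm x ≫ g = (yonEquiv (r := op r)).symm (g.hom.app r x) := by
  apply (IsInstance R).hom_ext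
  apply coyonedaEquiv.injective
  change coyonedaEquiv (coyonedaEquiv.symm x ≫ g.hom) = coyonedaEquiv (coyonedaEquiv.symm (g.hom.app r x))
  rw [coyonedaEquiv_comp]
  simp

/-- A schema mapping: a functor on entities and a transformation of observables over it that is the
identity on types. -/
structure SchemaMapping (R S : Schema 𝒯) where
  ent : R.Ent ⥤ S.Ent
  obs : R.obs ⟶ ent.op ⋙ S.obs

namespace SchemaMapping

variable {R S : Schema 𝒯} (F : SchemaMapping R S)

/-- The map on objects of the functor between collages. -/
def collageObj : Collage R → Collage S
  | .ent e => .ent (F.ent.obj e)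
  | .typ τ => .typ τ

/-- The map on morphisms of the functor between collages. -/
def collageMap : ∀ {x y : Collage R}, (x ⟶ y) → (F.collageObj x ⟶ F.collageObj y)
  | .ent a, .ent b, f => F.ent.map (X := a) (Y := b) f
  | .ent a, .typ τ, f => (F.obs.app (op a)).app τ f
  | .typ _, .typ _, f => f

/-- The functor between collages induced by a schema mapping. -/
def collage : Collage R ⥤ Collage S where
  obj := F.collageObj
  map := F.collageMap
  map_id x := by
    cases x
    · exact F.ent.map_id _
    · rfl
  map_comp {x y z} f g := by
    cases x <;> cases y <;> cases z <;> first | exact f.elim | exact g.elim | skip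
    · exact F.ent.map_comp _ _
    · exact ConcreteCategory.congr_hom (NatTrans.congr_app (F.obs.naturality (Quiver.Hom.op f)) _) g
    · exact ConcreteCategory.congr_hom ((F.obs.app _).naturality g) f
    · rfl

/-- `Δ_F`: precomposition of instances with the functor between collages. -/
def delta : Inst S ⥤ Inst R :=
  (IsInstance R).lift ((IsInstance S).ι ⋙ (Functor.whiskeringLeft _ _ _).obj F.collage)
    (fun J => J.property)

end SchemaMapping

/-- A bimodule from `R` to `S`: a functor from the opposite of the collage of `R` to the instances
on `S` that agrees with the Yoneda embedding on types. -/
structure Bimodule (R S : Schema 𝒯) where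
  functor : (Collage R)ᵒᵖ ⥤ Inst S
  restrict_type : (inclType R).op ⋙ functor = (inclType S).op ⋙ yon S

namespace SchemaMapping

variable {R S : Schema 𝒯} (F : SchemaMapping R S)

/-- The companion of `F`: the Yoneda embedding of `S` precomposed with `F`. -/
def companion : Bimodule R S where
  functor := F.collage.op ⋙ yon S
  restrict_type := rfl

/-- The conjoint of `F`: the Yoneda embedding of `S` followed by `Δ_F`. -/
def conjoint : Bimodule S R where
  functor := yon S ⋙ F.delta
  restrict_type := by
    have hobj : ∀ τ : 𝒯, F.collage ⋙ coyoneda.obj (op ((inclType S).obj τ)) =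
        coyoneda.obj (op ((inclType R).obj τ)) := fun τ => by
      refine Functor.hext (fun x => by cases x <;> rfl) (fun x y f => ?_)
      cases x <;> cases y <;> first | exact f.elim | skip
      · refine heq_of_eq ?_; ext z; exact z.elim
      · refine heq_of_eq ?_; ext z; exact z.elim
      · rfl
    have hnat : ∀ {G G' H H' : Collage R ⥤ Type u} (a : G ⟶ H) (b : G' ⟶ H'), G = G' → H = H' →
        (∀ x, HEq (a.app x) (b.app x)) → HEq a b := by
      rintro G _ H _ a b rfl rfl h
      exact heq_of_eq (NatTrans.ext (funext fun x => eq_of_heq (h x)))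
    have hι : ∀ {X Y X' Y' : Inst R} (a : X ⟶ Y) (b : X' ⟶ Y'), X.obj = X'.obj → Y.obj = Y'.obj →
        HEq a.hom b.hom → HEq a b := by
      rintro ⟨X, _⟩ ⟨Y, _⟩ ⟨X', _⟩ ⟨Y', _⟩ ⟨a⟩ ⟨b⟩ h h' hab
      dsimp at h h' hab
      subst h h' hab
      rfl
    refine Functor.hext (fun τ => ObjectProperty.FullSubcategory.ext (hobj τ.unop))
      (fun σ τ f => hι _ _ (hobj σ.unop) (hobj τ.unop)
        (hnat _ _ (hobj σ.unop) (hobj τ.unop) (fun x => ?_)))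
    cases x
    · refine heq_of_eq ?_; ext z; exact z.elim
    · rfl

end SchemaMapping

namespace Bimodule

variable {R S : Schema 𝒯} (M : Bimodule R S)

/-- The functor `J ↦ Hom(M(-), J)`, with values in all functors on the collage. -/
def gammaPre : Inst S ⥤ Collage R ⥤ Type u :=
  yoneda ⋙ (Functor.whiskeringLeft _ _ _).obj M.functor.rightOp

/-- The Yoneda lemma for instances, naturally in the object of the collage. -/
def yonIso (J : Inst S) : (yon S).rightOp ⋙ yoneda.obj J ≅ J.obj :=
  NatIso.ofComponents
    (fun s => (yonEquiv (r := op s)).toIso)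
    (fun {s t} f => by
      ext a
      exact (coyonedaEquiv_naturality (F := J.obj) a.hom f).symm)

theorem isInstance_gammaPre (J : Inst S) : IsInstance R (M.gammaPre.obj J) := by
  change PreservesFiniteProducts (((inclType R).op ⋙ M.functor).rightOp ⋙ yoneda.obj J)
  rw [M.restrict_type]
  have : PreservesFiniteProducts (inclType S ⋙ J.obj) := J.property
  exact ⟨fun n => preservesLimitsOfShape_of_natIso
    (Functor.isoWhiskerLeft (inclType S) (yonIso J)).symm⟩

/-- `Γ_M`: the functor `J ↦ Hom(M(-), J)` from instances on `S` to instances on `R`. -/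
def gamma : Inst S ⥤ Inst R :=
  (IsInstance R).lift M.gammaPre M.isInstance_gammaPre

variable [HasFiniteProducts 𝒯]

instance : (yon R).HasPointwiseLeftKanExtension M.functor := fun I =>
  have := HasColimitsOfSize.has_colimits_of_shape (C := Inst S) (CostructuredArrow (yon R) I)
  HasColimitsOfShape.has_colimit _

/-- `Λ_M`: the left Kan extension of `M` along the Yoneda embedding of `R`. It is pointwise, see
`isColimitLambda`. -/
noncomputable def lambda : Inst R ⥤ Inst S := (yon R).leftKanExtension M.functor

/-- The transformation `M ⟶ Λ_M ∘ y` of the Kan extension. -/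
noncomputable def lambdaUnit : M.functor ⟶ yon R ⋙ M.lambda :=
  (yon R).leftKanExtensionUnit M.functor

/-- `Λ_M(I)` is the colimit of `M(r)` over the elements of `I`. -/
noncomputable def isColimitLambda (I : Inst R) :
    IsColimit ((Functor.LeftExtension.mk M.lambda M.lambdaUnit).coconeAt I) :=
  (yon R).isPointwiseLeftKanExtensionLeftKanExtensionUnit M.functor I

/-- The cocone under the diagram of `Λ_M(I)` given by a morphism `I ⟶ Γ_M(J)`. -/
noncomputable def lambdaGammaCocone {I : Inst R} {J : Inst S} (h : I ⟶ M.gamma.obj J) :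
    Cocone (CostructuredArrow.proj (yon R) I ⋙ M.functor) where
  pt := J
  ι := {
    app := fun c => h.hom.app c.left.unop (yonEquiv c.hom)
    naturality := fun c d f => by
      have hw : (yon R).map f.left ≫ d.hom = c.hom := CostructuredArrow.w f
      have hn := ConcreteCategory.congr_hom (C := Type u) (h.hom.naturality f.left.unop)
        (yonEquiv d.hom)
      have he : I.obj.map f.left.unop (yonEquiv d.hom) = yonEquiv c.hom := by
        rw [← hw]
        exact coyonedaEquiv_naturality (F := I.obj) d.hom.hom f.left.unop
      refine Eq.trans ?_ (Category.comp_id _).symm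
      rw [← he]
      exact hn.symm }

/-- The canonical bijection `Hom(Λ_M I, J) ≃ Hom(I, Γ_M J)`: a morphism `g` corresponds to the map
sending `x ∈ I(r)` to `M(r) ⟶ Λ_M(y(r)) ⟶ Λ_M(I) ⟶ J`. -/
noncomputable def lambdaGammaHomEquiv (I : Inst R) (J : Inst S) :
    (M.lambda.obj I ⟶ J) ≃ (I ⟶ M.gamma.obj J) where
  toFun g := ⟨{
    app := fun r => TypeCat.ofHom fun x =>
      M.lambdaUnit.app (op r) ≫ M.lambda.map (yonEquiv.symm x) ≫ g
    naturality := fun r s f => by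
      ext x
      change M.lambdaUnit.app (op s) ≫ M.lambda.map (yonEquiv.symm (I.obj.map f x)) ≫ g =
        M.functor.map f.op ≫ M.lambdaUnit.app (op r) ≫ M.lambda.map (yonEquiv.symm x) ≫ g
      rw [yonEquiv_symm_map, Functor.map_comp, Category.assoc]
      exact (M.lambdaUnit.naturality_assoc f.op _).symm }⟩
  invFun h := (M.isColimitLambda I).desc (M.lambdaGammaCocone h)
  left_inv g := (M.isColimitLambda I).hom_ext fun c => by
    rw [IsColimit.fac]
    change M.lambdaUnit.app c.left ≫ M.lambda.map (yonEquiv.symm (yonEquiv c.hom)) ≫ g =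
      (M.lambdaUnit.app c.left ≫ M.lambda.map c.hom) ≫ g
    rw [Equiv.symm_apply_apply, Category.assoc]
  right_inv h := by
    apply (IsInstance R).hom_ext
    ext r x
    have := (M.isColimitLambda I).fac (M.lambdaGammaCocone h) (CostructuredArrow.mk (yonEquiv.symm x))
    refine (Category.assoc _ _ _).symm.trans (this.trans ?_)
    exact congrArg (h.hom.app r) (coyonedaEquiv.apply_symm_apply x)

/-- The adjunction `Λ_M ⊣ Γ_M`. -/
noncomputable def lambdaGammaAdj : M.lambda ⊣ M.gamma :=
  Adjunction.mkOfHomEquiv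
    { homEquiv := M.lambdaGammaHomEquiv
      homEquiv_naturality_left_symm := fun {I' I J} f g => by
        rw [Equiv.symm_apply_eq]
        apply (IsInstance R).hom_ext
        ext r x
        have h := (M.lambdaGammaHomEquiv I J).apply_symm_apply g
        have h' := ConcreteCategory.congr_hom
          (NatTrans.congr_app (congrArg (fun k => k.hom) h) r) (f.hom.app r x)
        refine h'.symm.trans ?_
        change M.lambdaUnit.app (op r) ≫ M.lambda.map (yonEquiv.symm (f.hom.app r x)) ≫ _ =
          M.lambdaUnit.app (op r) ≫ M.lambda.map (yonEquiv.symm x) ≫ M.lambda.map f ≫ _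
        rw [← yonEquiv_symm_comp, Functor.map_comp, Category.assoc]
      homEquiv_naturality_right := fun {I J J'} f g => by
        apply (IsInstance R).hom_ext
        ext r x
        change M.lambdaUnit.app (op r) ≫ M.lambda.map (yonEquiv.symm x) ≫ f ≫ g =
          (M.lambdaUnit.app (op r) ≫ M.lambda.map (yonEquiv.symm x) ≫ f) ≫ g
        simp only [Category.assoc] }

end Bimodule

namespace SchemaMapping

variable {R S : Schema 𝒯} (F : SchemaMapping R S) 

/-- `Δ_F` has a left adjoint: left Kan extension followed by reflection into instances. -/
instance [HasFiniteProducts 𝒯] : F.delta.IsRightAdjoint :=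
  ⟨_, ⟨(((F.collage.lanAdjunction (Type u)).comp
    (Adjunction.ofIsRightAdjoint (IsInstance S).ι)).restrictFullyFaithful
      (IsInstance R).fullyFaithfulι (Functor.FullyFaithful.id _)
      (L := (IsInstance R).ι ⋙ F.collage.lan ⋙ (IsInstance S).ι.leftAdjoint)
      (Iso.refl _) (Iso.refl _))⟩⟩

/-- Morphisms from a type into the image of the functor between collages lift. -/
def liftType {τ : 𝒯} : ∀ c : Collage R,
    ((inclType S).obj τ ⟶ F.collage.obj c) → ((inclType R).obj τ ⟶ c)
  | .typ _, f => f
  | .ent _, f => PEmpty.elim f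

theorem map_liftType {τ : 𝒯} : ∀ (c : Collage R)
    (f : (inclType S).obj τ ⟶ F.collage.obj c), F.collage.map (F.liftType c f) = f
  | .typ _, _ => rfl
  | .ent _, f => PEmpty.elim f

theorem liftType_map {τ : 𝒯} : ∀ (c : Collage R)
    (f : (inclType R).obj τ ⟶ c), F.liftType c (F.collage.map f) = f
  | .typ _, _ => rfl
  | .ent _, f => PEmpty.elim f

/-- The comma category of a type over the functor between collages has an initial object. -/
def isInitialType (τ : 𝒯) : IsInitial (StructuredArrow.mk (T := F.collage)
    (S := (inclType S).obj τ) (Y := (inclType R).obj τ) (𝟙 _)) :=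
  IsInitial.ofUniqueHom
    (fun X => StructuredArrow.homMk (F.liftType X.right X.hom)
      ((Category.id_comp _).trans (F.map_liftType _ _)))
    (fun X m => by
      apply StructuredArrow.hom_ext
      have h : F.collage.map m.right = X.hom :=
        (Category.id_comp (F.collage.map m.right)).symm.trans (StructuredArrow.w m)
      exact (F.liftType_map _ m.right).symm.trans (congrArg _ h))

/-- Right Kan extension along the functor between collages preserves instances. -/
theorem isInstance_ran (I : Inst R) : IsInstance S (F.collage.ran.obj I.obj) := by
  let α : inclType S ⋙ F.collage.ran.obj I.obj ⟶ inclType R ⋙ I.obj :=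
    Functor.whiskerLeft (inclType R) (F.collage.ranCounit.app I.obj)
  have : ∀ τ, IsIso (α.app τ) := fun τ => by
    have h := F.collage.isPointwiseRightKanExtensionRanCounit I.obj ((inclType S).obj τ)
    have := IsLimit.isIso_π_app_of_isInitial h _ (F.isInitialType τ)
    have e : α.app τ = (F.collage.ran.obj I.obj).map (𝟙 ((inclType S).obj τ)) ≫
        (F.collage.ranCounit.app I.obj).app ((inclType R).obj τ) := by
      rw [CategoryTheory.Functor.map_id]
      exact (Category.id_comp _).symm
    rw [e]
    exact this
  have : IsIso α := NatIso.isIso_of_isIso_app α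
  have : PreservesFiniteProducts (inclType R ⋙ I.obj) := I.property
  exact ⟨fun n => preservesLimitsOfShape_of_natIso (asIso α).symm⟩

/-- `Δ_F` has a right adjoint: right Kan extension. -/
instance : F.delta.IsLeftAdjoint :=
  ⟨_, ⟨(F.collage.ranAdjunction (Type u)).restrictFullyFaithful
      (IsInstance S).fullyFaithfulι (IsInstance R).fullyFaithfulι
      (R := (IsInstance S).lift ((IsInstance R).ι ⋙ F.collage.ran) F.isInstance_ran)
      (Iso.refl _) (Iso.refl _)⟩⟩


/-- `Π_F`: the right adjoint of `Δ_F`. -/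
noncomputable def pi : Inst R ⥤ Inst S := F.delta.rightAdjoint
/-- The adjunction `Δ_F ⊣ Π_F`. -/
noncomputable def deltaPiAdj : F.delta ⊣ F.pi := Adjunction.ofIsLeftAdjoint F.delta
variable [HasFiniteProducts 𝒯]
/-- `Σ_F`: the left adjoint of `Δ_F`. -/
noncomputable def sigma : Inst R ⥤ Inst S := F.delta.leftAdjoint
/-- The adjunction `Σ_F ⊣ Δ_F`. -/
noncomputable def sigmaDeltaAdj : F.sigma ⊣ F.delta := Adjunction.ofIsRightAdjoint F.delta

end SchemaMapping
end Schemas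
end AlgData

namespace AlgData

/-! Only the right adjoints need to be computed, and there the Yoneda lemma for instances suffices.
For the companion, `Γ(J)(r) = Hom(y(F r), J) ≅ J(F r) = Δ_F(J)(r)`. For the conjoint, `Γ(J)(s) =
Hom(Δ_F(y s), J) ≅ Hom(y s, Π_F J) ≅ Π_F(J)(s)`, the middle bijection being the adjunction `Δ_F ⊣
Π_F`. These give β and δ (`deltaIsoGamma`, `piIsoGamma`).

The isomorphisms α and γ then come from uniqueness of left adjoints: `Σ_F` and Λ of the companion
are left adjoint to isomorphic functors, and so are `Δ_F` and Λ of the conjoint. No colimit defining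
Λ is inspected. Taking α and γ to be the uniqueness isomorphisms relative to β and δ makes the
compatibility with the adjunctions automatic (`exists_ofNatIsoLeft_ofNatIsoRight_eq`), whichever β
and δ were chosen. -/

/-- Replacing the right adjoint by an isomorphic functor forces a compatible replacement of the
left adjoint. -/
theorem exists_ofNatIsoLeft_ofNatIsoRight_eq {C D : Type*} [Category* C] [Category* D]
    {L L' : C ⥤ D} {G G' : D ⥤ C} (adj : L ⊣ G) (adj' : L' ⊣ G') (β : G ≅ G') :
    ∃ α : L ≅ L', (adj.ofNatIsoLeft α).ofNatIsoRight β = adj' := by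
  -- After moving `adj` along β, both `L` and `L'` are left adjoint to the same functor `G'`, so
  -- they are canonically isomorphic. An adjunction between fixed functors is determined by its
  -- unit, so only units have to be compared.
  refine ⟨(adj.ofNatIsoRight β).leftAdjointUniq adj', Adjunction.ext ?_⟩
  ext X
  have h := (adj.ofNatIsoRight β).unit_leftAdjointUniq_hom_app adj' X
  rw [← h]
  -- Both sides are now the unit of `adj` followed by the uniqueness isomorphism and β, in the two
  -- possible orders; they agree by naturality of β.
  simp [Adjunction.ofNatIsoLeft, Adjunction.ofNatIsoRight]

variable {𝒯 : Type u} [SmallCategory 𝒯] {R S : Schema 𝒯}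

/-! ### The right adjoints Γ of the companion and the conjoint -/

namespace SchemaMapping

variable (F : SchemaMapping R S)

/-- `Δ_F` is `Γ` of the companion, by the Yoneda lemma. -/
def deltaIsoGamma : F.delta ≅ F.companion.gamma :=
  NatIso.ofComponents
    (fun J => (IsInstance R).isoMk
      -- Since the companion is `y ∘ F`, its Γ at `J` is by definition `Hom(y(-), J)` restricted
      -- along the collage functor, so the Yoneda isomorphism only has to be whiskered.
      (Functor.isoWhiskerLeft F.collage (Bimodule.yonIso J)).symm)
    (fun {J K} g => by
      apply (IsInstance R).hom_ext
      ext r x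
      -- Naturality in the instance: composing the morphism named by `x` with `g` names the image of
      -- `x` under `g`.
      exact (yonEquiv_symm_comp (R := S) (r := F.collage.obj r) x g).symm)

/-- `Π_F` is `Γ` of the conjoint, by the Yoneda lemma and the adjunction `Δ_F ⊣ Π_F`. -/
noncomputable def piIsoGamma : F.pi ≅ F.conjoint.gamma :=
  NatIso.ofComponents
    -- An element of `Π_F(J)(s)` is read as a morphism `y(s) ⟶ Π_F J` and then transposed to `Δ_F(y
    -- s) ⟶ J`. Naturality in `s` of the second step is naturality of transposition in its left
    -- variable.
    (fun J => (IsInstance S).isoMk ((Bimodule.yonIso (F.pi.obj J)).symm ≪≫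
      NatIso.ofComponents
        (fun s => (F.deltaPiAdj.homEquiv ((yon S).obj (op s)) J).symm.toIso)
        (fun {s t} f => by
          ext a
          exact F.deltaPiAdj.homEquiv_naturality_left_symm ((yon S).map f.op) a)))
    (fun {J K} g => by
      apply (IsInstance S).hom_ext
      ext s x
      -- Naturality in `J` splits the same way: Yoneda turns the action of `Π_F g` on `x` into
      -- postcomposition, and transposition carries this to postcomposition with `g`.
      refine Eq.trans ?_ (F.deltaPiAdj.homEquiv_naturality_right_symm
        ((yonEquiv (r := op s)).symm x) g)
      exact congrArg (F.deltaPiAdj.homEquiv ((yon S).obj (op s)) K).symm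
        (yonEquiv_symm_comp x (F.pi.map g)).symm)

end SchemaMapping

end AlgData

theorem mainTheorem9 {𝒯 : Type u} [SmallCategory 𝒯] [HasFiniteProducts 𝒯]
    (R S : AlgData.Schema 𝒯) (F : AlgData.SchemaMapping R S) :
    ∃ (α : F.sigma ≅ F.companion.lambda) (β : F.delta ≅ F.companion.gamma)
      (γ : F.delta ≅ F.conjoint.lambda) (δ : F.pi ≅ F.conjoint.gamma),
      (F.sigmaDeltaAdj.ofNatIsoLeft α).ofNatIsoRight β = F.companion.lambdaGammaAdj ∧
      (F.deltaPiAdj.ofNatIsoLeft γ).ofNatIsoRight δ = F.conjoint.lambdaGammaAdj := by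
  -- β and δ are fixed first; each then determines the matching isomorphism of left adjoints. In the
  -- second pair `Δ_F` plays the left adjoint, which is how it becomes a Λ.
  obtain ⟨α, hα⟩ := AlgData.exists_ofNatIsoLeft_ofNatIsoRight_eq F.sigmaDeltaAdj
    F.companion.lambdaGammaAdj F.deltaIsoGamma
  obtain ⟨γ, hγ⟩ := AlgData.exists_ofNatIsoLeft_ofNatIsoRight_eq F.deltaPiAdj
    F.conjoint.lambdaGammaAdj F.piIsoGamma
  exact ⟨α, F.deltaIsoGamma, γ, F.piIsoGamma, hα, hγ⟩
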